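/- Let $\mathcal H$ be a complex Hilbert space of dimension at least $2$. For a bounded linear operator $T\in\mathcal B(\mathcal H)$ let $W(T)=\{\langle Tx,x\rangle : x\in\mathcal H,\ \|x\|=1\}$ be its numerical range and $w(T)=\sup\{|\mu| : \mu\in W(T)\}$ its numerical radius. Let $S(\pi/2)=\{z\in\mathbb C : \operatorname{Re} z\ge 0\}$ and $$\tau(\pi/2)=\sup\{\|T\|/w(T) : T\in\mathcal B(\mathcal H),\ T\neq 0,\ W(T)\subseteq S(\pi/2)\}.$$ Then $\tau(\pi/2)=\sqrt2$. Moreover, suppose that $T\in\mathcal B(\mathcal H)$ is nonzero, that $T+T^*$ is positive semidefinite, and that $\|T\|/w(T)=\tau(\pi/2)$. Then for every orthonormal pair $e_1,e_2$ in $\mathcal H$ there is a sequence of unitary operators $U_m\in\mathcal B(\mathcal H)$, $m=1,2,\dots$, such that, writing $$U_m^*TU_m/\|T\|=\begin{pmatrix}T_{11}(m)&T_{12}(m)\\ T_{21}(m)&T_{22}(m)\end{pmatrix}$$ with respect to $\mathcal H=V\oplus V^\perp$, $V=\operatorname{span}\{e_1,e_2\}$, where $T_{11}(m)\in M_2(\mathbb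 C)$ is the matrix with entries $\langle (U_m^*TU_m/\|T\|)e_j,e_i\rangle$, one has $$T_{11}(m)\longrightarrow\begin{pmatrix}2/3&1/\sqrt3\\-1/\sqrt3&0\end{pmatrix}\qquad(m\to\infty).$$ -/

import Mathlib

open Filter Topology

/-- The numerical range `W(T) = {⟨Tx, x⟩ : ‖x‖ = 1}` (Mathlib's inner product is conjugate-linear
in its first argument, so `⟨Tx, x⟩` of the mathematical literature is `inner ℂ x (T x)`). -/
def numRange {H : Type*} [NormedAddCommGroup H] [InnerProductSpace ℂ H] (T : H →L[ℂ] H) : Set ℂ :=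
  {z | ∃ x : H, ‖x‖ = 1 ∧ inner ℂ x (T x) = z}

/-- The numerical radius `w(T) = sup {|μ| : μ ∈ W(T)}`. -/
noncomputable def numRadius {H : Type*} [NormedAddCommGroup H] [InnerProductSpace ℂ H]
    (T : H →L[ℂ] H) : ℝ :=
  sSup ((fun z : ℂ => ‖z‖) '' numRange T)

/-- The supremum defining the numerical radius is over a set bounded by `‖T‖`. -/
theorem norm_le_of_mem_numRange {H : Type*} [NormedAddCommGroup H] [InnerProductSpace ℂ H]
    (T : H →L[ℂ] H) {z : ℂ} (hz : z ∈ numRange T) : ‖z‖ ≤ ‖T‖ := by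
  obtain ⟨x, hx, rfl⟩ := hz
  calc ‖inner ℂ x (T x)‖ ≤ ‖x‖ * ‖T x‖ := norm_inner_le_norm x (T x)
    _ ≤ ‖x‖ * (‖T‖ * ‖x‖) := by gcongr; exact T.le_opNorm x
    _ = ‖T‖ := by rw [hx]; ring

/-- The sector `S(α) = {a + ib : |b| ≤ a tan α}` for `0 < α ≤ π/2`, written without the tangent so
that `S(π/2)` is the closed right half-plane (see the two lemmas below). -/
def sector (α : ℝ) : Set ℂ :=
  {z | |z.im| * Real.cos α ≤ z.re * Real.sin α}

theorem mem_sector_iff_tan {α : ℝ} (h0 : 0 < α) (h1 : α < Real.pi / 2) (z : ℂ) :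
    z ∈ sector α ↔ |z.im| ≤ z.re * Real.tan α := by
  have hc : 0 < Real.cos α := Real.cos_pos_of_mem_Ioo ⟨by linarith, h1⟩
  rw [Real.tan_eq_sin_div_cos, ← mul_div_assoc, le_div_iff₀ hc]
  rfl

theorem mem_sector_pi_div_two (z : ℂ) : z ∈ sector (Real.pi / 2) ↔ 0 ≤ z.re := by
  simp [sector]

/-- `τ(α) = sup {‖T‖ / w(T) : T ∈ B(H), T ≠ 0, W(T) ⊆ S(α)}`. -/
noncomputable def tauRatio (H : Type*) [NormedAddCommGroup H] [InnerProductSpace ℂ H]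
    (α : ℝ) : ℝ :=
  sSup {r | ∃ T : H →L[ℂ] H, T ≠ 0 ∧ numRange T ⊆ sector α ∧ r = ‖T‖ / numRadius T}

/-- The `2 × 2` block of the operator `A` with respect to the orthonormal pair `e 0`, `e 1`: its
`(i, j)` entry is `⟨A e_j, e_i⟩`. This is the `(1,1)` block of the operator matrix of `A` on
`V ⊕ Vᗮ`, where `V` is the span of `e 0`, `e 1`, identified with `ℂ²` through this basis. -/
noncomputable def leadingBlock {H : Type*} [NormedAddCommGroup H] [InnerProductSpace ℂ H]
    (e : Fin 2 → H) (A : H →L[ℂ] H) : Matrix (Fin 2) (Fin 2) ℂ :=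
  Matrix.of fun i j => inner ℂ (e i) (A (e j))

/-! Put `W = √2 * numRadius T`. If `Re T ≥ 0`, the numerical range lies in a half-disc, which is
contained in the triangle with vertices `W`, `iW`, `-iW`. Hence `T = A*A + i B*B - i C*C` with `A*A
+ B*B + C*C = W` (`exists_triangle_decomposition`), and `W(‖x‖² + ‖y‖²) - 2 Re⟨Tx, y⟩` is a sum of
three squares (`triangle_identity`). This gives `‖T‖ ≤ W`; an explicit rank-two operator shows that
`√2` is attained.

In the extremal case, scaled to `‖T‖ = W = 1`, take a norming sequence `x` and `y = Tx`. The squares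
tend to zero, so `Tx` acts like `x`, `ix`, `-ix` under `A`, `B`, `C`. The disc bound at `Tx ± ix`
then forces the weights `‖Ax‖²`, `‖Bx‖²`, `‖Cx‖²` to tend to `1/2`, `1/4`, `1/4`, which fixes all
limits of inner products among `x`, `Tx`, `T²x` that are needed (`tendsto_inner_of_norming`).
Orthonormalizing `x + Tx`, `x - Tx` produces the limit matrix, and unitaries carry the given pair to
these pairs. -/

theorem abs_re_add_abs_im_le (z : ℂ) : |z.re| + |z.im| ≤ √2 * ‖z‖ := by
  rw [Complex.norm_eq_sqrt_sq_add_sq, ← Real.sqrt_mul (by norm_num)]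
  apply Real.le_sqrt_of_sq_le
  nlinarith [sq_nonneg (|z.re| - |z.im|), sq_abs z.re, sq_abs z.im]

/-! ### Numerical radius, the triangle decomposition and the bound `‖T‖ ≤ √2 w(T)`. -/

section
variable {H : Type*} [NormedAddCommGroup H] [InnerProductSpace ℂ H]

theorem norm_inner_le_numRadius (T : H →L[ℂ] H) (x : H) :
    ‖inner ℂ x (T x)‖ ≤ numRadius T * ‖x‖ ^ 2 := by
  rcases eq_or_ne x 0 with rfl | hx
  · simp
  have hx' : ‖x‖ ≠ 0 := norm_ne_zero_iff.mpr hx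
  have hmem : inner ℂ (((‖x‖ : ℂ)⁻¹) • x) (T (((‖x‖ : ℂ)⁻¹) • x)) ∈ numRange T :=
    ⟨_, by simp [norm_smul, hx'], rfl⟩
  have hle : ‖inner ℂ (((‖x‖ : ℂ)⁻¹) • x) (T (((‖x‖ : ℂ)⁻¹) • x))‖ ≤ numRadius T :=
    le_csSup ⟨‖T‖, by rintro _ ⟨z, hz, rfl⟩; exact norm_le_of_mem_numRange T hz⟩ ⟨_, hmem, rfl⟩
  have e : ‖inner ℂ (((‖x‖ : ℂ)⁻¹) • x) (T (((‖x‖ : ℂ)⁻¹) • x))‖ * ‖x‖ ^ 2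
      = ‖inner ℂ x (T x)‖ := by
    rw [map_smul, inner_smul_left, inner_smul_right]
    simp only [norm_mul, RCLike.norm_conj, norm_inv, Complex.norm_real, norm_norm]
    field_simp
  rw [← e]
  gcongr

theorem numRadius_nonneg (T : H →L[ℂ] H) : 0 ≤ numRadius T := by
  apply Real.sSup_nonneg
  rintro _ ⟨z, -, rfl⟩
  exact norm_nonneg z

theorem numRadius_le {T : H →L[ℂ] H} {w : ℝ} (hw : 0 ≤ w)
    (h : ∀ x, ‖x‖ = 1 → ‖inner ℂ x (T x)‖ ≤ w) : numRadius T ≤ w := by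
  apply Real.sSup_le _ hw
  rintro _ ⟨_, ⟨x, hx, rfl⟩, rfl⟩
  exact h x hx

theorem re_inner_nonneg_of_numRange_subset {T : H →L[ℂ] H}
    (h : numRange T ⊆ sector (Real.pi / 2)) (x : H) : 0 ≤ (inner ℂ x (T x)).re := by
  rcases eq_or_ne x 0 with rfl | hx
  · simp
  have hx' : ‖x‖ ≠ 0 := norm_ne_zero_iff.mpr hx
  have hre := (mem_sector_pi_div_two _).1
    (h ⟨((‖x‖ : ℂ)⁻¹) • x, by simp [norm_smul, hx'], rfl⟩)
  have e : inner ℂ (((‖x‖ : ℂ)⁻¹) • x) (T (((‖x‖ : ℂ)⁻¹) • x))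
      = (((‖x‖⁻¹) ^ 2 : ℝ) : ℂ) * inner ℂ x (T x) := by
    rw [map_smul, inner_smul_left, inner_smul_right]
    simp
    ring
  rw [e, Complex.re_ofReal_mul] at hre
  exact nonneg_of_mul_nonneg_right hre (by positivity)

/-- Each square completes one term of the decomposition: the coefficients `1`, `i`, `-i` have
modulus one, so each shifted square contributes its share of `W(‖x‖² + ‖y‖²)` and of the cross term.
The identity yields the norm bound by positivity, and near-equality in that bound makes all three
squares small. -/
theorem triangle_identity {T A B C : H →L[ℂ] H} {W : ℝ}
    (h1 : ∀ u v, (W : ℂ) * inner ℂ u v =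
        inner ℂ (A u) (A v) + inner ℂ (B u) (B v) + inner ℂ (C u) (C v))
    (hT : ∀ u v, inner ℂ u (T v) =
        inner ℂ (A u) (A v) + Complex.I * inner ℂ (B u) (B v)
          - Complex.I * inner ℂ (C u) (C v)) (x y : H) :
    W * (‖x‖ ^ 2 + ‖y‖ ^ 2) - 2 * (inner ℂ y (T x)).re =
      ‖A (y - x)‖ ^ 2 + ‖B (y - Complex.I • x)‖ ^ 2 + ‖C (y + Complex.I • x)‖ ^ 2 := by
  have hn : ∀ z : H, (((‖z‖ ^ 2 : ℝ)) : ℂ) = inner ℂ z z := fun z => by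
    rw [inner_self_eq_norm_sq_to_K]; simp
  have hr : (2 * (inner ℂ y (T x)).re : ℂ) = inner ℂ y (T x) + starRingEnd ℂ (inner ℂ y (T x)) := by
    generalize inner ℂ y (T x) = z
    apply Complex.ext <;> simp
    ring
  apply Complex.ofReal_injective
  push_cast
  simp only [← Complex.ofReal_pow, hn, hr, mul_add, h1]
  simp only [hT, map_add, map_sub, map_smul, inner_add_left, inner_add_right, inner_sub_left,
    inner_sub_right, inner_smul_left, inner_smul_right, map_mul, inner_conj_symm, Complex.conj_I]
  linear_combination (inner ℂ (B x) (B x) + inner ℂ (C x) (C x)) * Complex.I_sq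

variable [CompleteSpace H]

theorem ContinuousLinearMap.IsPositive.exists_factor {P : H →L[ℂ] H} (hP : P.IsPositive) :
    ∃ S : H →L[ℂ] H, ∀ u v, inner ℂ u (P v) = inner ℂ (S u) (S v) := by
  obtain ⟨S, rfl⟩ := CStarAlgebra.nonneg_iff_eq_star_mul_self.mp
    ((ContinuousLinearMap.nonneg_iff_isPositive P).mpr hP)
  refine ⟨S, fun u v => ?_⟩
  rw [ContinuousLinearMap.star_eq_adjoint, mul_apply_eq_comp,
    ContinuousLinearMap.adjoint_inner_right]

/-- An operator whose numerical range lies in the triangle with vertices `W`, `iW`, `-iW` is a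
combination of these vertices with positive operator coefficients summing to the identity. -/
theorem exists_triangle_decomposition {T : H →L[ℂ] H} {W : ℝ}
    (hre : ∀ x, 0 ≤ (inner ℂ x (T x)).re)
    (hW : ∀ x, √2 * ‖inner ℂ x (T x)‖ ≤ W * ‖x‖ ^ 2) :
    ∃ A B C : H →L[ℂ] H,
      (∀ u v, (W : ℂ) * inner ℂ u v =
        inner ℂ (A u) (A v) + inner ℂ (B u) (B v) + inner ℂ (C u) (C v)) ∧
      ∀ u v, inner ℂ u (T v) =
        inner ℂ (A u) (A v) + Complex.I * inner ℂ (B u) (B v)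
          - Complex.I * inner ℂ (C u) (C v) := by
  set T' := ContinuousLinearMap.adjoint T
  have hT : ∀ x, inner ℂ (T x) x = starRingEnd ℂ (inner ℂ x (T x)) := fun x =>
    (inner_conj_symm _ _).symm
  have hT' : ∀ x, inner ℂ (T' x) x = inner ℂ x (T x) := fun x =>
    ContinuousLinearMap.adjoint_inner_left _ _ _
  have hxx : ∀ x : H, inner ℂ x x = ((‖x‖ ^ 2 : ℝ) : ℂ) := fun x => by
    rw [inner_self_eq_norm_sq_to_K]; simp
  have hb := fun x => (abs_re_add_abs_im_le (inner ℂ x (T x))).trans (hW x)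
  have h1 : ((1 / 2 : ℂ) • (T + T')).IsPositive := by
    rw [ContinuousLinearMap.isPositive_iff_complex]
    intro x
    have e : inner ℂ (((1 / 2 : ℂ) • (T + T')) x) x = (((inner ℂ x (T x)).re : ℝ) : ℂ) := by
      simp only [smul_apply, add_apply, inner_smul_left,
        inner_add_left, hT, hT']
      generalize inner ℂ x (T x) = z
      apply Complex.ext <;> simp [map_ofNat]
      ring
    rw [e]
    exact ⟨rfl, hre x⟩
  -- Barycentric coordinates in the triangle, scaled by `W`: `Re z` and `(W - Re z ± Im z) / 2`.
  -- Here `-(i/2)(T - T')` is `Im T`.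
  have h2 : ((1 / 2 : ℂ) • ((W : ℂ) • (1 : H →L[ℂ] H) - (1 / 2 : ℂ) • (T + T')
      - (Complex.I / 2) • (T - T'))).IsPositive := by
    rw [ContinuousLinearMap.isPositive_iff_complex]
    intro x
    have e : inner ℂ (((1 / 2 : ℂ) • ((W : ℂ) • (1 : H →L[ℂ] H) - (1 / 2 : ℂ) • (T + T')
      - (Complex.I / 2) • (T - T'))) x) x = (((W * ‖x‖ ^ 2 - (inner ℂ x (T x)).re
        + (inner ℂ x (T x)).im) / 2 : ℝ) : ℂ) := by
      simp only [smul_apply, add_apply, inner_smul_left,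
        inner_add_left, inner_sub_left, sub_apply,
        one_apply_eq_self, hT, hT', hxx]
      generalize inner ℂ x (T x) = z
      generalize ‖x‖ ^ 2 = n
      apply Complex.ext <;> simp [map_ofNat, map_div₀]
      ring
    rw [e]
    refine ⟨rfl, ?_⟩
    have := hb x
    have := le_abs_self (inner ℂ x (T x)).re
    have := neg_abs_le (inner ℂ x (T x)).im
    simp only [RCLike.re_eq_complex_re, Complex.ofReal_re]
    linarith
  have h3 : ((1 / 2 : ℂ) • ((W : ℂ) • (1 : H →L[ℂ] H) - (1 / 2 : ℂ) • (T + T')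
      + (Complex.I / 2) • (T - T'))).IsPositive := by
    rw [ContinuousLinearMap.isPositive_iff_complex]
    intro x
    have e : inner ℂ (((1 / 2 : ℂ) • ((W : ℂ) • (1 : H →L[ℂ] H) - (1 / 2 : ℂ) • (T + T')
      + (Complex.I / 2) • (T - T'))) x) x = (((W * ‖x‖ ^ 2 - (inner ℂ x (T x)).re
        - (inner ℂ x (T x)).im) / 2 : ℝ) : ℂ) := by
      simp only [smul_apply, add_apply, inner_smul_left,
        inner_add_left, inner_sub_left, sub_apply,
        one_apply_eq_self, hT, hT', hxx]
      generalize inner ℂ x (T x) = z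
      generalize ‖x‖ ^ 2 = n
      apply Complex.ext <;> simp [map_ofNat, map_div₀]
      ring
    rw [e]
    refine ⟨rfl, ?_⟩
    have := hb x
    have := le_abs_self (inner ℂ x (T x)).re
    have := le_abs_self (inner ℂ x (T x)).im
    simp only [RCLike.re_eq_complex_re, Complex.ofReal_re]
    linarith
  obtain ⟨A, hA⟩ := h1.exists_factor
  obtain ⟨B, hB⟩ := h2.exists_factor
  obtain ⟨C, hC⟩ := h3.exists_factor
  refine ⟨A, B, C, fun u v => ?_, fun u v => ?_⟩
  · rw [← hA, ← hB, ← hC]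
    simp only [smul_apply, add_apply, inner_smul_right,
      inner_add_right, inner_sub_right, sub_apply,
      one_apply_eq_self]
    ring
  · rw [← hA, ← hB, ← hC]
    simp only [smul_apply, add_apply, inner_smul_right,
      inner_add_right, inner_sub_right, sub_apply,
      one_apply_eq_self]
    linear_combination (1 / 2 : ℂ) * (inner ℂ u (T v) - inner ℂ u (T' v)) * Complex.I_sq

theorem norm_le_of_triangle {T : H →L[ℂ] H} {W : ℝ} (hW0 : 0 ≤ W)
    (hre : ∀ x, 0 ≤ (inner ℂ x (T x)).re)
    (hW : ∀ x, √2 * ‖inner ℂ x (T x)‖ ≤ W * ‖x‖ ^ 2) : ‖T‖ ≤ W := by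
  obtain ⟨A, B, C, h1, hT⟩ := exists_triangle_decomposition hre hW
  refine ContinuousLinearMap.opNorm_le_of_re_inner_le hW0 fun x y hx hy => ?_
  have := triangle_identity h1 hT x y
  have hs : RCLike.re (inner ℂ (T x) y) = (inner ℂ y (T x)).re := by
    exact inner_re_symm (𝕜 := ℂ) _ _
  rw [hs]
  rw [hx, hy] at this
  nlinarith [sq_nonneg ‖A (y - x)‖, sq_nonneg ‖B (y - Complex.I • x)‖,
    sq_nonneg ‖C (y + Complex.I • x)‖]

theorem norm_le_sqrt_two_mul_numRadius {T : H →L[ℂ] H}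
    (hre : ∀ x, 0 ≤ (inner ℂ x (T x)).re) : ‖T‖ ≤ √2 * numRadius T :=
  norm_le_of_triangle (mul_nonneg (Real.sqrt_nonneg 2) (numRadius_nonneg T)) hre fun x => by
    rw [mul_assoc]
    gcongr
    exact norm_inner_le_numRadius T x
end

/-! ### Asymptotics along a norming sequence. -/

section
variable {H : Type*} [NormedAddCommGroup H] [InnerProductSpace ℂ H]

theorem tendsto_inner_zero_of_bounded {u v : ℕ → H} {M : ℝ} (hv : ∀ m, ‖v m‖ ≤ M)
    (hu : Tendsto u atTop (𝓝 0)) : Tendsto (fun m => inner ℂ (u m) (v m)) atTop (𝓝 0) := by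
  refine squeeze_zero_norm (a := fun m => ‖u m‖ * M) (fun m => ?_) ?_
  · exact (norm_inner_le_norm _ _).trans (by gcongr; exact hv m)
  · simpa using hu.norm.mul_const M

theorem tendsto_inner_sub_of_tendsto_sub_smul {u u' v : ℕ → H} {α β : ℂ} {M : ℝ}
    (hv : ∀ m, ‖v m‖ ≤ M)
    (hu : Tendsto (fun m => u m - α • v m) atTop (𝓝 0))
    (hu' : Tendsto (fun m => u' m - β • v m) atTop (𝓝 0)) :
    Tendsto (fun m => inner ℂ (u m) (u' m) - starRingEnd ℂ α * β * ((‖v m‖ ^ 2 : ℝ) : ℂ))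
      atTop (𝓝 0) := by
  have h1 := hu.inner hu' (𝕜 := ℂ)
  have h2 := (tendsto_inner_zero_of_bounded hv hu).const_mul β
  have h3 := ((tendsto_inner_zero_of_bounded hv hu').star).const_mul (starRingEnd ℂ α)
  have h := (h1.add h2).add h3
  simp only [inner_zero_left, star_zero, mul_zero, add_zero] at h
  refine h.congr fun m => ?_
  have hn : ((‖v m‖ ^ 2 : ℝ) : ℂ) = inner ℂ (v m) (v m) := by
    rw [inner_self_eq_norm_sq_to_K]; simp
  rw [hn]
  simp only [← starRingEnd_apply, inner_sub_left, inner_sub_right, inner_smul_left,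
    inner_smul_right, map_sub, map_mul, Complex.conj_conj, inner_conj_symm]
  ring

theorem tendsto_norm_sq_sub_of_tendsto_sub_smul {u v : ℕ → H} {α : ℂ} {M : ℝ}
    (hv : ∀ m, ‖v m‖ ≤ M) (hu : Tendsto (fun m => u m - α • v m) atTop (𝓝 0)) :
    Tendsto (fun m => ‖u m‖ ^ 2 - ‖α‖ ^ 2 * ‖v m‖ ^ 2) atTop (𝓝 0) := by
  have h := (Complex.continuous_re.tendsto _).comp
    (tendsto_inner_sub_of_tendsto_sub_smul hv hu hu)
  simp only [Complex.zero_re] at h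
  refine h.congr fun m => ?_
  have hn : inner ℂ (u m) (u m) = ((‖u m‖ ^ 2 : ℝ) : ℂ) := by
    rw [inner_self_eq_norm_sq_to_K]; simp
  have ha : starRingEnd ℂ α * α = ((‖α‖ ^ 2 : ℝ) : ℂ) := by
    rw [Complex.conj_mul']; simp
  simp only [Function.comp, hn, ha, ← Complex.ofReal_mul, ← Complex.ofReal_sub, Complex.ofReal_re]

theorem tendsto_inner_of_tendsto_sub_smul {u u' v : ℕ → H} {α β : ℂ} {M p : ℝ}
    (hv : ∀ m, ‖v m‖ ≤ M) (hp : Tendsto (fun m => ‖v m‖ ^ 2) atTop (𝓝 p))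
    (hu : Tendsto (fun m => u m - α • v m) atTop (𝓝 0))
    (hu' : Tendsto (fun m => u' m - β • v m) atTop (𝓝 0)) :
    Tendsto (fun m => inner ℂ (u m) (u' m)) atTop (𝓝 (starRingEnd ℂ α * β * p)) := by
  have h := (tendsto_inner_sub_of_tendsto_sub_smul hv hu hu').add
    (((Complex.continuous_ofReal.tendsto p).comp hp).const_mul (starRingEnd ℂ α * β))
  rw [zero_add] at h
  refine h.congr fun m => ?_
  simp [Function.comp]

/-- Quantifies that the half-disc touches each slanted side of the triangle only at its midpoint: if
one weight `ε` vanishes in the limit, the disc bound makes the other two agree. Expanding the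
hypothesis gives `(a - b)² ≤ 2aε + 6bε - ε² ≤ 8Mε`. -/
theorem tendsto_sub_zero_of_sq_le {a b ε : ℕ → ℝ} {M : ℝ} (ha : ∀ m, a m ≤ M)
    (hb : ∀ m, b m ≤ M) (hε0 : ∀ m, 0 ≤ ε m) (hε : Tendsto ε atTop (𝓝 0))
    (h : ∀ m, 2 * (a m ^ 2 + (b m - ε m) ^ 2) ≤ (a m + b m + ε m) ^ 2) :
    Tendsto (fun m => a m - b m) atTop (𝓝 0) := by
  have hsq : Tendsto (fun m => (a m - b m) ^ 2) atTop (𝓝 0) := by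
    refine squeeze_zero (g := fun m => 8 * M * ε m) (fun m => sq_nonneg _) (fun m => ?_) ?_
    · nlinarith [h m, mul_nonneg (hε0 m) (sub_nonneg.2 (ha m)),
        mul_nonneg (hε0 m) (sub_nonneg.2 (hb m)), sq_nonneg (ε m)]
    · simpa using hε.const_mul (8 * M)
  have := hsq.sqrt
  simp only [Real.sqrt_sq_eq_abs, Real.sqrt_zero] at this
  exact (tendsto_zero_iff_abs_tendsto_zero _).2 this

theorem two_mul_sq_norm_le_of_sqrt_two_mul_norm_le {a b c n : ℝ} {z : ℂ}
    (hz : z = a + Complex.I * b - Complex.I * c) (h : √2 * ‖z‖ ≤ n) :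
    2 * (a ^ 2 + (b - c) ^ 2) ≤ n ^ 2 := by
  have e : ‖z‖ ^ 2 = a ^ 2 + (b - c) ^ 2 := by
    rw [Complex.sq_norm, Complex.normSq_apply, hz]
    simp
    ring
  have h2 := pow_le_pow_left₀ (by positivity) h 2
  rwa [mul_pow, Real.sq_sqrt (by norm_num), e] at h2

variable [CompleteSpace H]

/-- Along a norming sequence of an operator of norm `1` whose numerical range lies in the right
half-plane and in the disc of radius `1 / √2`, the Gram matrices of `x`, `T x` and the compressions
of `T` to their spans converge. -/
theorem tendsto_inner_of_norming {T : H →L[ℂ] H}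
    (hre : ∀ x, 0 ≤ (inner ℂ x (T x)).re) (hW : ∀ x, √2 * ‖inner ℂ x (T x)‖ ≤ ‖x‖ ^ 2)
    {x : ℕ → H} (hx : ∀ m, ‖x m‖ ≤ 1) (hTx : Tendsto (fun m => ‖T (x m)‖) atTop (𝓝 1)) :
    Tendsto (fun m => inner ℂ (x m) (x m)) atTop (𝓝 1) ∧
    Tendsto (fun m => inner ℂ (T (x m)) (T (x m))) atTop (𝓝 1) ∧
    Tendsto (fun m => inner ℂ (x m) (T (x m))) atTop (𝓝 (1 / 2)) ∧
    Tendsto (fun m => inner ℂ (x m) (T (T (x m)))) atTop (𝓝 0) ∧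
    Tendsto (fun m => inner ℂ (T (x m)) (T (T (x m)))) atTop (𝓝 (1 / 2)) := by
  have hW' : ∀ x, √2 * ‖inner ℂ x (T x)‖ ≤ 1 * ‖x‖ ^ 2 := by simpa using hW
  have hT1 : ‖T‖ ≤ 1 := norm_le_of_triangle zero_le_one hre hW'
  have hTle : ∀ v, ‖T v‖ ≤ ‖v‖ := fun v => by
    simpa using T.le_of_opNorm_le hT1 v
  have hn : ∀ z : H, inner ℂ z z = ((‖z‖ ^ 2 : ℝ) : ℂ) := fun z => by
    rw [inner_self_eq_norm_sq_to_K]; simp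
  have hx1 : Tendsto (fun m => ‖x m‖) atTop (𝓝 1) :=
    tendsto_of_tendsto_of_tendsto_of_le_of_le hTx tendsto_const_nhds (fun m => hTle _) hx
  obtain ⟨A, B, C, hABC, hT⟩ := exists_triangle_decomposition hre hW'
  have hid := fun m => triangle_identity hABC hT (x m) (T (x m))
  have hsum : ∀ v, ‖v‖ ^ 2 = ‖A v‖ ^ 2 + ‖B v‖ ^ 2 + ‖C v‖ ^ 2 := fun v => by
    have := hABC v v
    simp only [hn, Complex.ofReal_one, one_mul] at this
    exact_mod_cast this
  -- With `W = 1` and `y = Tx` the defect in `triangle_identity` is `‖x‖² - ‖Tx‖²`.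
  have hdef : Tendsto (fun m => ‖A (T (x m) - x m)‖ ^ 2 + ‖B (T (x m) - Complex.I • x m)‖ ^ 2 +
      ‖C (T (x m) + Complex.I • x m)‖ ^ 2) atTop (𝓝 0) := by
    have h := (hx1.pow 2).sub (hTx.pow 2)
    simp only [one_pow, sub_self] at h
    refine h.congr fun m => ?_
    rw [← hid m, hn, Complex.ofReal_re]
    ring
  have hto : ∀ (S : H →L[ℂ] H) (d : ℕ → H), (∀ m, ‖S (d m)‖ ^ 2 ≤
      ‖A (T (x m) - x m)‖ ^ 2 + ‖B (T (x m) - Complex.I • x m)‖ ^ 2 +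
      ‖C (T (x m) + Complex.I • x m)‖ ^ 2) → Tendsto (fun m => S (d m)) atTop (𝓝 0) := by
    intro S d h
    have h2 := (squeeze_zero (fun m => sq_nonneg _) h hdef).sqrt
    simp only [Real.sqrt_sq (norm_nonneg _), Real.sqrt_zero] at h2
    exact tendsto_zero_iff_norm_tendsto_zero.2 h2
  have hA : Tendsto (fun m => A (T (x m)) - (1 : ℂ) • A (x m)) atTop (𝓝 0) := by
    simpa using hto A (fun m => T (x m) - x m) fun m => by
      linarith [sq_nonneg ‖B (T (x m) - Complex.I • x m)‖,
        sq_nonneg ‖C (T (x m) + Complex.I • x m)‖]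
  have hB : Tendsto (fun m => B (T (x m)) - Complex.I • B (x m)) atTop (𝓝 0) := by
    simpa using hto B (fun m => T (x m) - Complex.I • x m) fun m => by
      linarith [sq_nonneg ‖A (T (x m) - x m)‖, sq_nonneg ‖C (T (x m) + Complex.I • x m)‖]
  have hC : Tendsto (fun m => C (T (x m)) - (-Complex.I) • C (x m)) atTop (𝓝 0) := by
    simpa using hto C (fun m => T (x m) + Complex.I • x m) fun m => by
      linarith [sq_nonneg ‖A (T (x m) - x m)‖, sq_nonneg ‖B (T (x m) - Complex.I • x m)‖]
  have hbd : ∀ v : H, ‖A v‖ ≤ ‖v‖ ∧ ‖B v‖ ≤ ‖v‖ ∧ ‖C v‖ ≤ ‖v‖ := fun v => by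
    have := hsum v
    refine ⟨?_, ?_, ?_⟩ <;> refine le_of_sq_le_sq ?_ (norm_nonneg _) <;>
    nlinarith [sq_nonneg ‖A v‖, sq_nonneg ‖B v‖, sq_nonneg ‖C v‖]
  have hAx : ∀ m, ‖A (x m)‖ ≤ 1 := fun m => (hbd _).1.trans (hx m)
  have hBx : ∀ m, ‖B (x m)‖ ≤ 1 := fun m => (hbd _).2.1.trans (hx m)
  have hCx : ∀ m, ‖C (x m)‖ ≤ 1 := fun m => (hbd _).2.2.trans (hx m)
  have hform : ∀ z, inner ℂ z (T z) = ((‖A z‖ ^ 2 : ℝ) : ℂ) + Complex.I * ((‖B z‖ ^ 2 : ℝ) : ℂ)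
      - Complex.I * ((‖C z‖ ^ 2 : ℝ) : ℂ) := fun z => by rw [hT, hn, hn, hn]
  have htest : ∀ z : H, 2 * ((‖A z‖ ^ 2) ^ 2 + (‖B z‖ ^ 2 - ‖C z‖ ^ 2) ^ 2)
      ≤ (‖A z‖ ^ 2 + ‖B z‖ ^ 2 + ‖C z‖ ^ 2) ^ 2 := fun z => by
    rw [← hsum z]
    exact two_mul_sq_norm_le_of_sqrt_two_mul_norm_le (hform z) (hW z)
  have hz2 : ∀ (c : ℂ), ‖c‖ = 1 → ∀ m, ‖T (x m) + c • x m‖ ≤ 2 := fun c hc m => by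
    refine (norm_add_le _ _).trans ?_
    rw [norm_smul, hc]
    linarith [hTle (x m), hx m]
  have hz4 : ∀ (S : H →L[ℂ] H), (∀ v, ‖S v‖ ≤ ‖v‖) → ∀ (c : ℂ), ‖c‖ = 1 → ∀ m,
      ‖S (T (x m) + c • x m)‖ ^ 2 ≤ 4 := fun S hS c hc m => by
    have := (hS _).trans (hz2 c hc m)
    nlinarith [norm_nonneg (S (T (x m) + c • x m))]
  have hshift : ∀ (S : H →L[ℂ] H) (c d : ℂ),
      Tendsto (fun m => S (T (x m)) - d • S (x m)) atTop (𝓝 0) →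
      Tendsto (fun m => S (T (x m) + c • x m) - (d + c) • S (x m)) atTop (𝓝 0) := by
    intro S c d h
    refine h.congr fun m => ?_
    rw [map_add, map_smul, add_smul]
    abel
  have hzero : ∀ {S : H →L[ℂ] H} {c d : ℂ}, d + c = 0 →
      Tendsto (fun m => S (T (x m)) - d • S (x m)) atTop (𝓝 0) →
      Tendsto (fun m => ‖S (T (x m) + c • x m)‖ ^ 2) atTop (𝓝 0) := by
    intro S c d hcd h
    have := hshift S c d h
    rw [hcd] at this
    simpa using (this.norm.pow 2)
  -- At `z = Tx - ix` the `B`-weight dies, while `Az ≈ (1 - i)Ax` and `Cz ≈ -2i Cx`; equality of the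
  -- remaining weights reads `2‖Ax‖² ≈ 4‖Cx‖²`. The vector `Tx + ix` does the same with `B` and `C`
  -- exchanged.
  have hpr : Tendsto (fun m => ‖A (x m)‖ ^ 2 - 2 * ‖C (x m)‖ ^ 2) atTop (𝓝 0) := by
    have h0 := tendsto_sub_zero_of_sq_le
      (hz4 A (fun v => (hbd v).1) (-Complex.I) (by simp))
      (hz4 C (fun v => (hbd v).2.2) (-Complex.I) (by simp)) (fun m => sq_nonneg _)
      (hzero (c := -Complex.I) (by simp) hB) fun m => by
        have := htest (T (x m) + (-Complex.I) • x m)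
        linarith
    have h1 := tendsto_norm_sq_sub_of_tendsto_sub_smul hAx (hshift A (-Complex.I) _ hA)
    have h2 := tendsto_norm_sq_sub_of_tendsto_sub_smul hCx (hshift C (-Complex.I) _ hC)
    have e1 : ‖(1 : ℂ) + -Complex.I‖ ^ 2 = 2 := by
      rw [Complex.sq_norm, Complex.normSq_apply]; norm_num
    have e2 : ‖-Complex.I + -Complex.I‖ ^ 2 = 4 := by
      rw [Complex.sq_norm, Complex.normSq_apply]; norm_num
    rw [e1] at h1
    rw [e2] at h2
    have h := ((h0.sub h1).add h2).const_mul (1 / 2)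
    simp only [sub_zero, add_zero, mul_zero] at h
    refine h.congr fun m => ?_
    ring
  have hpq : Tendsto (fun m => ‖A (x m)‖ ^ 2 - 2 * ‖B (x m)‖ ^ 2) atTop (𝓝 0) := by
    have h0 := tendsto_sub_zero_of_sq_le
      (hz4 A (fun v => (hbd v).1) Complex.I (by simp))
      (hz4 B (fun v => (hbd v).2.1) Complex.I (by simp)) (fun m => sq_nonneg _)
      (hzero (c := Complex.I) (by simp) hC) fun m => by
        have := htest (T (x m) + Complex.I • x m)
        linarith
    have h1 := tendsto_norm_sq_sub_of_tendsto_sub_smul hAx (hshift A Complex.I _ hA)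
    have h2 := tendsto_norm_sq_sub_of_tendsto_sub_smul hBx (hshift B Complex.I _ hB)
    have e1 : ‖(1 : ℂ) + Complex.I‖ ^ 2 = 2 := by
      rw [Complex.sq_norm, Complex.normSq_apply]; norm_num
    have e2 : ‖Complex.I + Complex.I‖ ^ 2 = 4 := by
      rw [Complex.sq_norm, Complex.normSq_apply]; norm_num
    rw [e1] at h1
    rw [e2] at h2
    have h := ((h0.sub h1).add h2).const_mul (1 / 2)
    simp only [sub_zero, add_zero, mul_zero] at h
    refine h.congr fun m => ?_
    ring
  have hs1 : Tendsto (fun m => ‖x m‖ ^ 2) atTop (𝓝 1) := by simpa using hx1.pow 2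
  -- The weights sum to `‖x‖² → 1` and are asymptotically in proportion `2 : 1 : 1`.
  have hp : Tendsto (fun m => ‖A (x m)‖ ^ 2) atTop (𝓝 (1 / 2 : ℝ)) := by
    have h := (hs1.add ((hpr.add hpq).const_mul (1 / 2))).const_mul (1 / 2)
    simp only [add_zero, mul_zero, mul_one] at h
    refine h.congr fun m => ?_
    rw [hsum (x m)]
    ring
  have hq : Tendsto (fun m => ‖B (x m)‖ ^ 2) atTop (𝓝 (1 / 4 : ℝ)) := by
    have h := (hp.sub hpq).const_mul (1 / 2)
    rw [show (1 / 2 : ℝ) * (1 / 2 - 0) = 1 / 4 by norm_num] at h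
    refine h.congr fun m => ?_
    ring
  have hr : Tendsto (fun m => ‖C (x m)‖ ^ 2) atTop (𝓝 (1 / 4 : ℝ)) := by
    have h := (hp.sub hpr).const_mul (1 / 2)
    rw [show (1 / 2 : ℝ) * (1 / 2 - 0) = 1 / 4 by norm_num] at h
    refine h.congr fun m => ?_
    ring
  have hself : ∀ (S : H →L[ℂ] H), Tendsto (fun m => S (x m) - (1 : ℂ) • S (x m)) atTop (𝓝 0) :=
    fun S => by simp
  refine ⟨?_, ?_, ?_, ?_, ?_⟩
  · have h := (Complex.continuous_ofReal.tendsto _).comp hs1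
    rw [Complex.ofReal_one] at h
    exact h.congr fun m => (hn _).symm
  · have h := (Complex.continuous_ofReal.tendsto _).comp (hTx.pow 2)
    rw [one_pow, Complex.ofReal_one] at h
    exact h.congr fun m => (hn _).symm
  · have h := ((tendsto_inner_of_tendsto_sub_smul hAx hp (hself A) (hself A)).add
      ((tendsto_inner_of_tendsto_sub_smul hBx hq (hself B) (hself B)).const_mul Complex.I)).sub
      ((tendsto_inner_of_tendsto_sub_smul hCx hr (hself C) (hself C)).const_mul Complex.I)
    simp only [← hT] at h
    convert h using 2
    simp
  · have h := ((tendsto_inner_of_tendsto_sub_smul hAx hp (hself A) hA).add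
      ((tendsto_inner_of_tendsto_sub_smul hBx hq (hself B) hB).const_mul Complex.I)).sub
      ((tendsto_inner_of_tendsto_sub_smul hCx hr (hself C) hC).const_mul Complex.I)
    simp only [← hT] at h
    convert h using 2
    simp
    linear_combination (-1 / 2 : ℂ) * Complex.I_sq
  · have h := ((tendsto_inner_of_tendsto_sub_smul hAx hp hA hA).add
      ((tendsto_inner_of_tendsto_sub_smul hBx hq hB hB).const_mul Complex.I)).sub
      ((tendsto_inner_of_tendsto_sub_smul hCx hr hC hC).const_mul Complex.I)
    simp only [← hT] at h
    convert h using 2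
    simp
end

/-! ### Unitaries carrying one orthonormal pair to another. -/

section
variable {H : Type*} [NormedAddCommGroup H] [InnerProductSpace ℂ H]

theorem exists_linearIsometryEquiv_of_finiteDimensional {E : Type*} [NormedAddCommGroup E]
    [InnerProductSpace ℂ E] [FiniteDimensional ℂ E] {e f : Fin 2 → E}
    (he : Orthonormal ℂ e) (hf : Orthonormal ℂ f) :
    ∃ U : E ≃ₗᵢ[ℂ] E, ∀ i, U (e i) = f i := by
  set n := Module.finrank ℂ E with hn
  have h2 : 2 ≤ n := by simpa using he.linearIndependent.fintype_card_le_finrank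
  have key : ∀ {g : Fin 2 → E}, Orthonormal ℂ g →
      ∃ b : OrthonormalBasis (Fin n) ℂ E, ∀ i, b (Fin.castLE h2 i) = g i := by
    intro g hg
    have hinj : Function.Injective (Fin.castLE h2) := Fin.castLE_injective h2
    set s : Set (Fin n) := Set.range (Fin.castLE h2)
    set v : Fin n → E := Function.extend (Fin.castLE h2) g 0
    have hv : ∀ i, v (Fin.castLE h2 i) = g i := fun i => hinj.extend_apply g 0 i
    have hon : Orthonormal ℂ (s.domRestrict v) := by
      have : s.domRestrict v = g ∘ (Equiv.ofInjective _ hinj).symm := by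
        funext ⟨_, i, rfl⟩
        rw [Function.comp_apply, Equiv.ofInjective_symm_apply]
        exact hv i
      rw [this]
      exact hg.comp _ (Equiv.injective _)
    obtain ⟨b, hb⟩ := hon.exists_orthonormalBasis_extension_of_card_eq (by simp [hn])
    exact ⟨b, fun i => (hb _ ⟨i, rfl⟩).trans (hv i)⟩
  obtain ⟨b, hb⟩ := key he
  obtain ⟨b', hb'⟩ := key hf
  refine ⟨b.equiv b' (Equiv.refl _), fun i => ?_⟩
  rw [← hb, ← hb', OrthonormalBasis.equiv_apply_basis]
  rfl

/-- The extension of a linear isometry equivalence of a subspace by the identity on its orthogonal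
complement. -/
noncomputable def extendByIdentity (S : Submodule ℂ H) [S.HasOrthogonalProjection]
    (V : S ≃ₗᵢ[ℂ] S) : H →ₗ[ℂ] H where
  toFun x := (V (S.orthogonalProjectionOnto x) : H) + (x - S.orthogonalProjectionOnto x)
  map_add' x y := by simp; abel
  map_smul' c x := by simp [smul_sub]

theorem orthogonalProjectionOnto_extendByIdentity (S : Submodule ℂ H) [S.HasOrthogonalProjection]
    (V : S ≃ₗᵢ[ℂ] S) (x : H) :
    S.orthogonalProjectionOnto (extendByIdentity S V x) = V (S.orthogonalProjectionOnto x) := by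
  have h : S.orthogonalProjectionOnto (x - S.orthogonalProjectionOnto x) = 0 :=
    S.orthogonalProjectionOnto_eq_zero_iff.2 (S.sub_starProjection_mem_orthogonal x)
  simp only [extendByIdentity, LinearMap.coe_mk, AddHom.coe_mk, map_add, h, add_zero]
  exact S.orthogonalProjectionOnto_mem_subspace_eq_self _

theorem extendByIdentity_extendByIdentity (S : Submodule ℂ H) [S.HasOrthogonalProjection]
    (V W : S ≃ₗᵢ[ℂ] S) (h : ∀ x, W (V x) = x) (x : H) :
    extendByIdentity S W (extendByIdentity S V x) = x := by
  change (W (S.orthogonalProjectionOnto (extendByIdentity S V x)) : H) +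
    (extendByIdentity S V x - S.orthogonalProjectionOnto (extendByIdentity S V x)) = x
  rw [orthogonalProjectionOnto_extendByIdentity, h]
  simp [extendByIdentity]

theorem norm_extendByIdentity (S : Submodule ℂ H) [S.HasOrthogonalProjection]
    (V : S ≃ₗᵢ[ℂ] S) (x : H) : ‖extendByIdentity S V x‖ = ‖x‖ := by
  have h : ∀ a : S, ‖(a : H) + (x - S.orthogonalProjectionOnto x)‖ ^ 2 =
      ‖a‖ ^ 2 + ‖x - S.orthogonalProjectionOnto x‖ ^ 2 := fun a => by
    have := norm_add_sq_eq_norm_sq_add_norm_sq_of_inner_eq_zero (𝕜 := ℂ) (a : H)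
      (x - S.orthogonalProjectionOnto x)
      ((S.mem_orthogonal _).1 (S.sub_starProjection_mem_orthogonal x) a a.2)
    simpa [sq] using this
  have h1 := h (V (S.orthogonalProjectionOnto x))
  have h2 := h (S.orthogonalProjectionOnto x)
  rw [V.norm_map, ← h2, add_sub_cancel] at h1
  exact (sq_eq_sq₀ (norm_nonneg _) (norm_nonneg _)).1 h1

variable [CompleteSpace H]

/-- The span of both pairs is finite-dimensional, so each pair extends to an orthonormal basis of
it; the map between these bases is then extended by the identity on the orthogonal complement. -/
theorem exists_unitary_of_orthonormal {e f : Fin 2 → H}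
    (he : Orthonormal ℂ e) (hf : Orthonormal ℂ f) :
    ∃ U : unitary (H →L[ℂ] H), ∀ i, (U : H →L[ℂ] H) (e i) = f i := by
  set S : Submodule ℂ H := Submodule.span ℂ (Set.range e ∪ Set.range f) with hS
  have : FiniteDimensional ℂ S :=
    FiniteDimensional.span_of_finite ℂ ((Set.finite_range e).union (Set.finite_range f))
  have heS : ∀ i, e i ∈ S := fun i => Submodule.subset_span (Or.inl ⟨i, rfl⟩)
  have hfS : ∀ i, f i ∈ S := fun i => Submodule.subset_span (Or.inr ⟨i, rfl⟩)
  have he' : Orthonormal ℂ (fun i => (⟨e i, heS i⟩ : S)) :=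
    (S.subtypeₗᵢ.orthonormal_comp_iff).1 he
  have hf' : Orthonormal ℂ (fun i => (⟨f i, hfS i⟩ : S)) :=
    (S.subtypeₗᵢ.orthonormal_comp_iff).1 hf
  obtain ⟨V, hV⟩ := exists_linearIsometryEquiv_of_finiteDimensional he' hf'
  let G : H ≃ₗᵢ[ℂ] H :=
    { extendByIdentity S V with
      invFun := extendByIdentity S V.symm
      left_inv := extendByIdentity_extendByIdentity S _ _ V.symm_apply_apply
      right_inv := extendByIdentity_extendByIdentity S _ _ V.apply_symm_apply
      norm_map' := norm_extendByIdentity S V }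
  refine ⟨Unitary.linearIsometryEquiv.symm G, fun i => ?_⟩
  change extendByIdentity S V (e i) = f i
  have hP : S.orthogonalProjectionOnto (e i) = ⟨e i, heS i⟩ :=
    S.orthogonalProjectionOnto_mem_subspace_eq_self ⟨e i, heS i⟩
  change (V (S.orthogonalProjectionOnto (e i)) : H) + (e i - S.orthogonalProjectionOnto (e i)) = f i
  rw [hP, hV]
  simp

theorem leadingBlock_conj (e : Fin 2 → H) (c : ℂ) (T : H →L[ℂ] H) (U : unitary (H →L[ℂ] H)) :
    leadingBlock e (c • (star (U : H →L[ℂ] H) * T * (U : H →L[ℂ] H))) =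
      leadingBlock (fun i => (U : H →L[ℂ] H) (e i)) (c • T) := by
  ext i j
  simp [leadingBlock, ContinuousLinearMap.star_eq_adjoint, ContinuousLinearMap.adjoint_inner_right]
end

/-! ### From limits of inner products to limits of blocks. -/

section
variable {H : Type*} [NormedAddCommGroup H] [InnerProductSpace ℂ H]

theorem tendsto_norm_of_tendsto_inner_self {a : ℕ → H} {r : ℝ}
    (h : Tendsto (fun m => inner ℂ (a m) (a m)) atTop (𝓝 (r : ℂ))) :
    Tendsto (fun m => ‖a m‖) atTop (𝓝 √r) := by
  have h1 := ((Complex.continuous_re.tendsto _).comp h).sqrt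
  rw [Complex.ofReal_re] at h1
  refine h1.congr fun m => ?_
  have hn : inner ℂ (a m) (a m) = ((‖a m‖ ^ 2 : ℝ) : ℂ) := by
    rw [inner_self_eq_norm_sq_to_K]; simp
  rw [Function.comp_apply, hn, Complex.ofReal_re, Real.sqrt_sq (norm_nonneg _)]

theorem orthonormal_normalize_pair {a b : H} (ha : a ≠ 0) (hb : b ≠ 0) (hab : inner ℂ b a = 0) :
    Orthonormal ℂ ![((‖b‖ : ℂ)⁻¹) • b, ((‖a‖ : ℂ)⁻¹) • a] := by
  have hba : inner ℂ a b = 0 := inner_eq_zero_symm.1 hab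
  refine ⟨fun i => ?_, fun i j hij => ?_⟩
  · fin_cases i <;> simp [norm_smul, ha, hb]
  · fin_cases i <;> fin_cases j <;> simp_all [inner_smul_left, inner_smul_right]

theorem exists_orthonormal_tendsto_leadingBlock {T : H →L[ℂ] H} {a s : ℕ → H}
    (haa : Tendsto (fun m => inner ℂ (a m) (a m)) atTop (𝓝 1))
    (hss : Tendsto (fun m => inner ℂ (s m) (s m)) atTop (𝓝 3))
    (has : Tendsto (fun m => inner ℂ (a m) (s m)) atTop (𝓝 0))
    (hsa : Tendsto (fun m => inner ℂ (s m) (a m)) atTop (𝓝 0))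
    (haTa : Tendsto (fun m => inner ℂ (a m) (T (a m))) atTop (𝓝 0))
    (haTs : Tendsto (fun m => inner ℂ (a m) (T (s m))) atTop (𝓝 (-1)))
    (hsTa : Tendsto (fun m => inner ℂ (s m) (T (a m))) atTop (𝓝 1))
    (hsTs : Tendsto (fun m => inner ℂ (s m) (T (s m))) atTop (𝓝 2)) :
    ∃ f : ℕ → Fin 2 → H, (∀ᶠ m in atTop, Orthonormal ℂ (f m)) ∧
      Tendsto (fun m => leadingBlock (f m) T) atTop
        (𝓝 !![(2 / 3 : ℂ), ((1 / √3 : ℝ) : ℂ); -((1 / √3 : ℝ) : ℂ), 0]) := by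
  -- Gram–Schmidt coefficient: subtracting `c • a` makes the pair exactly orthogonal as soon as `a ≠
  -- 0`, and since `c → 0` the limits for `s` carry over to `b`.
  set c : ℕ → ℂ := fun m => inner ℂ (a m) (s m) / inner ℂ (a m) (a m) with hc
  have hc0 : Tendsto c atTop (𝓝 0) := by
    have h := has.div haa one_ne_zero
    rwa [zero_div] at h
  have hc0' : Tendsto (fun m => starRingEnd ℂ (c m)) atTop (𝓝 0) := by
    have h := (Complex.continuous_conj.tendsto 0).comp hc0
    rwa [map_zero] at h
  set b : ℕ → H := fun m => s m - c m • a m with hb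
  have hbb : Tendsto (fun m => inner ℂ (b m) (b m)) atTop (𝓝 3) := by
    have h := ((hss.sub (hc0.mul hsa)).sub (hc0'.mul has)).add ((hc0'.mul hc0).mul haa)
    simp only [zero_mul, sub_zero, add_zero] at h
    refine h.congr fun m => ?_
    simp only [hb, inner_sub_left, inner_sub_right, inner_smul_left, inner_smul_right]
    ring
  have hbTb : Tendsto (fun m => inner ℂ (b m) (T (b m))) atTop (𝓝 2) := by
    have h := ((hsTs.sub (hc0.mul hsTa)).sub (hc0'.mul haTs)).add ((hc0'.mul hc0).mul haTa)
    simp only [zero_mul, sub_zero, add_zero] at h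
    refine h.congr fun m => ?_
    simp only [hb, map_sub, map_smul, inner_sub_left, inner_sub_right, inner_smul_left,
      inner_smul_right]
    ring
  have hbTa : Tendsto (fun m => inner ℂ (b m) (T (a m))) atTop (𝓝 1) := by
    have h := hsTa.sub (hc0'.mul haTa)
    simp only [zero_mul, sub_zero] at h
    refine h.congr fun m => ?_
    simp only [hb, inner_sub_left, inner_smul_left]
  have haTb : Tendsto (fun m => inner ℂ (a m) (T (b m))) atTop (𝓝 (-1)) := by
    have h := haTs.sub (hc0.mul haTa)
    simp only [zero_mul, sub_zero] at h
    refine h.congr fun m => ?_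
    simp only [hb, map_sub, map_smul, inner_sub_right, inner_smul_right]
  have hna : Tendsto (fun m => ((‖a m‖ : ℂ))⁻¹) atTop (𝓝 1) := by
    have h := tendsto_norm_of_tendsto_inner_self (r := 1) (by simpa using haa)
    rw [Real.sqrt_one] at h
    simpa using ((Complex.continuous_ofReal.tendsto _).comp h).inv₀ (by simp)
  have hnb : Tendsto (fun m => ((‖b m‖ : ℂ))⁻¹) atTop (𝓝 (((√3)⁻¹ : ℝ) : ℂ)) := by
    have h := tendsto_norm_of_tendsto_inner_self (r := 3) (by simpa using hbb)
    simpa using ((Complex.continuous_ofReal.tendsto _).comp h).inv₀ (by simp)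
  refine ⟨fun m => ![((‖b m‖ : ℂ)⁻¹) • b m, ((‖a m‖ : ℂ)⁻¹) • a m], ?_, ?_⟩
  · filter_upwards [haa.eventually_ne one_ne_zero, hbb.eventually_ne three_ne_zero] with m h1 h2
    refine orthonormal_normalize_pair (by rintro h; simp [h] at h1) (by rintro h; simp [h] at h2)
      (inner_eq_zero_symm.1 ?_)
    simp only [hb, inner_sub_right, inner_smul_right, hc]
    field_simp
    ring
  · refine tendsto_pi_nhds.2 fun i => tendsto_pi_nhds.2 fun j => ?_
    have hsq : ((√3 : ℝ) : ℂ) * ((√3 : ℝ) : ℂ) = 3 := by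
      rw [← Complex.ofReal_mul, Real.mul_self_sqrt (by norm_num)]; simp
    have h3 : ((√3 : ℝ) : ℂ) ≠ 0 := by intro h; simp [h] at hsq
    have hinv : (((√3 : ℝ) : ℂ))⁻¹ * (((√3 : ℝ) : ℂ))⁻¹ = 1 / 3 := by
      rw [← mul_inv, hsq]; norm_num
    fin_cases i <;> fin_cases j
    · convert (hnb.mul hnb).mul hbTb using 1
      · funext m
        simp [leadingBlock]
        ring
      · simp [hinv]
        norm_num
    · convert (hnb.mul hna).mul hbTa using 1
      · funext m
        simp [leadingBlock]
        ring
      · simp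
    · convert (hnb.mul hna).mul haTb using 1
      · funext m
        simp [leadingBlock]
        ring
      · simp
    · convert (hna.mul hna).mul haTa using 1
      · funext m
        simp [leadingBlock]
        ring
      · simp

theorem exists_norming_sequence {T : H →L[ℂ] H} (hT : ‖T‖ = 1) :
    ∃ x : ℕ → H, (∀ m, ‖x m‖ ≤ 1) ∧ Tendsto (fun m => ‖T (x m)‖) atTop (𝓝 1) := by
  have h : ∀ m : ℕ, ∃ x : H, ‖x‖ < 1 ∧ 1 - 1 / ((m : ℝ) + 1) < ‖T x‖ := fun m =>
    T.exists_lt_apply_of_lt_opNorm (by rw [hT]; linarith [Nat.one_div_pos_of_nat (α := ℝ) (n := m)])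
  choose x hx hTx using h
  refine ⟨x, fun m => (hx m).le, tendsto_of_tendsto_of_tendsto_of_le_of_le
    (g := fun m : ℕ => 1 - 1 / ((m : ℝ) + 1)) ?_ tendsto_const_nhds (fun m => (hTx m).le)
    fun m => ?_⟩
  · simpa using tendsto_one_div_add_atTop_nhds_zero_nat.const_sub (1 : ℝ)
  · exact (T.le_opNorm _).trans (by rw [hT, one_mul]; exact (hx m).le)

/-! ### An operator attaining the ratio `√2`. -/

theorem exists_orthonormal_pair (hH : 1 < Module.rank ℂ H) : ∃ e : Fin 2 → H, Orthonormal ℂ e := by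
  have hnt : Nontrivial H := rank_pos_iff_nontrivial.1 (zero_lt_one.trans hH)
  obtain ⟨x, hx⟩ := exists_ne (0 : H)
  obtain ⟨y, hy⟩ := exists_linearIndependent_pair_of_one_lt_rank hH hx
  exact ⟨_, InnerProductSpace.gramSchmidtNormed_orthonormal hy⟩

/-- The operator with matrix `!![2/3, 1/√3; -1/√3, 0]` on the span of `e 0`, `e 1` that vanishes on
the orthogonal complement. -/
noncomputable def extremalOperator (e : Fin 2 → H) : H →L[ℂ] H :=
  (2 / 3 : ℂ) • InnerProductSpace.rankOne ℂ (e 0) (e 0) +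
    (((√3)⁻¹ : ℝ) : ℂ) • (InnerProductSpace.rankOne ℂ (e 0) (e 1) -
      InnerProductSpace.rankOne ℂ (e 1) (e 0))

theorem extremalOperator_apply (e : Fin 2 → H) (v : H) :
    extremalOperator e v = ((2 / 3 : ℂ) * inner ℂ (e 0) v + (((√3)⁻¹ : ℝ) : ℂ) * inner ℂ (e 1) v) • e 0
      - ((((√3)⁻¹ : ℝ) : ℂ) * inner ℂ (e 0) v) • e 1 := by
  simp only [extremalOperator, add_apply, smul_apply, sub_apply, InnerProductSpace.rankOne_apply]
  module

theorem inner_extremalOperator (e : Fin 2 → H) (v : H) :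
    inner ℂ v (extremalOperator e v) =
      ((2 / 3 * ‖inner ℂ (e 0) v‖ ^ 2 : ℝ) : ℂ) + Complex.I *
        ((2 * (√3)⁻¹ * (starRingEnd ℂ (inner ℂ (e 0) v) * inner ℂ (e 1) v).im : ℝ) : ℂ) := by
  rw [extremalOperator_apply, inner_sub_right, inner_smul_right, inner_smul_right,
    ← inner_conj_symm v (e 0), ← inner_conj_symm v (e 1), Complex.sq_norm, Complex.normSq_apply]
  generalize inner ℂ (e 0) v = α
  generalize inner ℂ (e 1) v = β
  generalize (√3)⁻¹ = c
  apply Complex.ext <;> simp <;> ring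

theorem re_inner_extremalOperator_nonneg (e : Fin 2 → H) (v : H) :
    0 ≤ (inner ℂ v (extremalOperator e v)).re := by
  rw [inner_extremalOperator, Complex.add_re, Complex.ofReal_re, Complex.I_mul_re,
    Complex.ofReal_im]
  simp only [neg_zero, add_zero]
  positivity

theorem norm_inner_extremalOperator_le {e : Fin 2 → H} (he : Orthonormal ℂ e) {v : H}
    (hv : ‖v‖ = 1) : ‖inner ℂ v (extremalOperator e v)‖ ≤ (√2)⁻¹ := by
  have hB : ‖inner ℂ (e 0) v‖ ^ 2 + ‖inner ℂ (e 1) v‖ ^ 2 ≤ 1 := by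
    simpa [Fin.sum_univ_two, hv] using he.sum_inner_products_le v (s := Finset.univ)
  have him : (starRingEnd ℂ (inner ℂ (e 0) v) * inner ℂ (e 1) v).im ^ 2 ≤
      ‖inner ℂ (e 0) v‖ ^ 2 * ‖inner ℂ (e 1) v‖ ^ 2 := by
    refine (sq_le_sq' (neg_le_of_abs_le (Complex.abs_im_le_norm _))
      (le_of_abs_le (Complex.abs_im_le_norm _))).trans_eq ?_
    rw [norm_mul, RCLike.norm_conj, mul_pow]
  have h3 : ((√3)⁻¹ : ℝ) ^ 2 = 1 / 3 := by
    rw [inv_pow, Real.sq_sqrt (by norm_num)]; norm_num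
  refine le_of_sq_le_sq ?_ (by positivity)
  rw [inv_pow, Real.sq_sqrt (by norm_num), inner_extremalOperator]
  generalize (starRingEnd ℂ (inner ℂ (e 0) v) * inner ℂ (e 1) v).im = d at *
  rw [Complex.sq_norm, Complex.normSq_apply]
  simp only [Complex.add_re, Complex.ofReal_re, Complex.I_mul_re, Complex.ofReal_im, neg_zero,
    add_zero, Complex.add_im, Complex.I_mul_im, zero_add]
  have e1 : 2 * (√3)⁻¹ * d * (2 * (√3)⁻¹ * d) = 4 / 3 * d ^ 2 := by
    linear_combination 4 * d ^ 2 * h3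
  rw [e1]
  -- With `p = ‖⟨e 0, v⟩‖²` and `d² ≤ p(1 - p)`, the left side is at most `4p/3 - 8p²/9 = 1/2 -
  -- (8/9)(p - 3/4)²`.
  nlinarith [sq_nonneg (‖inner ℂ (e 0) v‖ ^ 2 - 3 / 4), sq_nonneg ‖inner ℂ (e 0) v‖,
    mul_nonneg (sq_nonneg ‖inner ℂ (e 0) v‖) (sub_nonneg.2 hB)]

theorem one_le_norm_extremalOperator {e : Fin 2 → H} (he : Orthonormal ℂ e) :
    1 ≤ ‖extremalOperator e‖ := by
  have h00 : inner ℂ (e 0) (e 0) = 1 := by simp [he.1 0]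
  have h11 : inner ℂ (e 1) (e 1) = 1 := by simp [he.1 1]
  have h01 : inner ℂ (e 0) (e 1) = 0 := he.2 (by decide)
  have h10 : inner ℂ (e 1) (e 0) = 0 := he.2 (by decide)
  have hs : (((√3)⁻¹ : ℝ) : ℂ) * (√3 : ℝ) = 1 := by
    rw [← Complex.ofReal_mul, inv_mul_cancel₀ (by positivity), Complex.ofReal_one]
  have hs2 : ((√3 : ℝ) : ℂ) * (√3 : ℝ) = 3 := by
    rw [← Complex.ofReal_mul, Real.mul_self_sqrt (by norm_num)]; simp
  -- The operator only flips the sign of the `e 1` component of this vector, so it preserves its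
  -- norm.
  set x : H := ((√3 : ℝ) : ℂ) • e 0 + e 1 with hx
  have hTx : extremalOperator e x = ((√3 : ℝ) : ℂ) • e 0 - e 1 := by
    rw [extremalOperator_apply, hx, inner_add_right, inner_add_right, inner_smul_right,
      inner_smul_right, h00, h11, h01, h10]
    have e1 : (2 / 3 : ℂ) * (((√3 : ℝ) : ℂ) * 1 + 0) + (((√3)⁻¹ : ℝ) : ℂ) * (((√3 : ℝ) : ℂ) * 0 + 1)
        = (√3 : ℝ) := by
      linear_combination (1 / 3 : ℂ) * (√3 : ℝ) * hs - (1 / 3 : ℂ) * (((√3)⁻¹ : ℝ) : ℂ) * hs2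
    rw [e1, mul_add, mul_one, mul_zero, add_zero, hs, one_smul]
  have hx0 : 0 < ‖x‖ := by
    rw [norm_pos_iff]
    intro h
    have : inner ℂ (e 1) x = 1 := by rw [hx, inner_add_right, inner_smul_right, h11, h10]; simp
    rw [h] at this
    simp at this
  have hnorm : ‖extremalOperator e x‖ = ‖x‖ := by
    rw [hTx, hx]
    have h : inner ℂ (((√3 : ℝ) : ℂ) • e 0) (e 1) = 0 := by rw [inner_smul_left, h01, mul_zero]
    have h1 := norm_add_sq_eq_norm_sq_add_norm_sq_of_inner_eq_zero _ _ h
    have h2 := norm_add_sq_eq_norm_sq_add_norm_sq_of_inner_eq_zero (𝕜 := ℂ)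
      (((√3 : ℝ) : ℂ) • e 0) (-e 1) (by rw [inner_neg_right, h, neg_zero])
    rw [norm_neg, ← sub_eq_add_neg] at h2
    exact (mul_self_inj (norm_nonneg _) (norm_nonneg _)).1 (h2.trans h1.symm)
  have := (extremalOperator e).le_opNorm x
  rw [hnorm] at this
  exact le_of_mul_le_mul_right (by simpa using this) hx0

/-! ### The value of `τ(π/2)` and the extremal operators. -/

variable [CompleteSpace H]

theorem tauRatio_pi_div_two (hH : 1 < Module.rank ℂ H) : tauRatio H (Real.pi / 2) = √2 := by
  refine IsGreatest.csSup_eq ⟨?_, ?_⟩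
  · obtain ⟨e, he⟩ := exists_orthonormal_pair hH
    have h1 := one_le_norm_extremalOperator he
    have h2 := norm_le_sqrt_two_mul_numRadius (re_inner_extremalOperator_nonneg e)
    have h3 : numRadius (extremalOperator e) ≤ (√2)⁻¹ :=
      numRadius_le (by positivity) fun v hv => norm_inner_extremalOperator_le he hv
    have h2pos : 0 < √2 := by positivity
    have hw : 0 < numRadius (extremalOperator e) :=
      pos_of_mul_pos_right (by linarith : 0 < √2 * numRadius (extremalOperator e)) h2pos.le
    refine ⟨extremalOperator e, by rintro h; rw [h, norm_zero] at h1; linarith, ?_, ?_⟩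
    · rintro _ ⟨v, -, rfl⟩
      exact (mem_sector_pi_div_two _).2 (re_inner_extremalOperator_nonneg e v)
    · refine le_antisymm ((le_div_iff₀ hw).2 ?_) ((div_le_iff₀ hw).2 h2)
      calc √2 * numRadius (extremalOperator e) ≤ √2 * (√2)⁻¹ := by gcongr
        _ = 1 := mul_inv_cancel₀ h2pos.ne'
        _ ≤ _ := h1
  · rintro _ ⟨T, -, hT, rfl⟩
    exact div_le_of_le_mul₀ (numRadius_nonneg T) (Real.sqrt_nonneg 2)
      (norm_le_sqrt_two_mul_numRadius (re_inner_nonneg_of_numRange_subset hT))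

theorem exists_orthonormal_tendsto_of_extremal {T : H →L[ℂ] H} (hT : ‖T‖ = 1)
    (hre : ∀ x, 0 ≤ (inner ℂ x (T x)).re) (hW : ∀ x, √2 * ‖inner ℂ x (T x)‖ ≤ ‖x‖ ^ 2) :
    ∃ f : ℕ → Fin 2 → H, (∀ᶠ m in atTop, Orthonormal ℂ (f m)) ∧
      Tendsto (fun m => leadingBlock (f m) T) atTop
        (𝓝 !![(2 / 3 : ℂ), ((1 / √3 : ℝ) : ℂ); -((1 / √3 : ℝ) : ℂ), 0]) := by
  obtain ⟨x, hx, hTx⟩ := exists_norming_sequence hT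
  obtain ⟨hxx, hyy, hxy, hxTy, hyTy⟩ := tendsto_inner_of_norming hre hW hx hTx
  have hyx : Tendsto (fun m => inner ℂ (T (x m)) (x m)) atTop (𝓝 (1 / 2)) := by
    have h := (Complex.continuous_conj.tendsto _).comp hxy
    simp only [map_div₀, map_one, map_ofNat] at h
    exact h.congr fun m => inner_conj_symm _ _
  -- In the limit `‖x‖ = ‖Tx‖ = 1` and `⟨x, Tx⟩` is real, so difference and sum are asymptotically
  -- orthogonal, with squared norms `2 - 1 = 1` and `2 + 1 = 3`.
  refine exists_orthonormal_tendsto_leadingBlock (a := fun m => x m - T (x m))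
    (s := fun m => x m + T (x m)) ?_ ?_ ?_ ?_ ?_ ?_ ?_ ?_ <;>
    simp only [map_add, map_sub, inner_add_left, inner_add_right, inner_sub_left, inner_sub_right]
  · convert (hxx.sub hyx).sub (hxy.sub hyy) using 2; norm_num
  · convert (hxx.add hyx).add (hxy.add hyy) using 2; norm_num
  · convert (hxx.sub hyx).add (hxy.sub hyy) using 2; norm_num
  · convert (hxx.add hyx).sub (hxy.add hyy) using 2; norm_num
  · convert (hxy.sub hyy).sub (hxTy.sub hyTy) using 2; norm_num
  · convert (hxy.sub hyy).add (hxTy.sub hyTy) using 2; norm_num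
  · convert (hxy.add hyy).sub (hxTy.add hyTy) using 2; norm_num
  · convert (hxy.add hyy).add (hxTy.add hyTy) using 2; norm_num
end

theorem corollary3p9 {H : Type*} [NormedAddCommGroup H] [InnerProductSpace ℂ H] [CompleteSpace H]
    (hH : 1 < Module.rank ℂ H) :
    tauRatio H (Real.pi / 2) = √2 ∧
    ∀ T : H →L[ℂ] H, T ≠ 0 → (T + ContinuousLinearMap.adjoint T).IsPositive →
      ‖T‖ / numRadius T = tauRatio H (Real.pi / 2) →
      ∀ e : Fin 2 → H, Orthonormal ℂ e →
        ∃ U : ℕ → unitary (H →L[ℂ] H),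
          Tendsto
            (fun m => leadingBlock e
              (((‖T‖ : ℂ)⁻¹) • (star (U m : H →L[ℂ] H) * T * (U m : H →L[ℂ] H))))
            atTop
            (𝓝 !![(2 / 3 : ℂ), ((1 / √3 : ℝ) : ℂ); -((1 / √3 : ℝ) : ℂ), 0]) := by
  refine ⟨tauRatio_pi_div_two hH, fun T hT0 hpos hτ e he => ?_⟩
  rw [tauRatio_pi_div_two hH] at hτ
  have hTpos : 0 < ‖T‖ := norm_pos_iff.2 hT0
  have hw : numRadius T ≠ 0 := by
    intro h
    rw [h, div_zero] at hτ
    exact (by positivity : (0 : ℝ) < √2).ne hτ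
  have hTw : ‖T‖ = √2 * numRadius T := (div_eq_iff hw).1 hτ
  have hre : ∀ x, 0 ≤ (inner ℂ x (T x)).re := fun x => by
    have h := hpos.re_inner_nonneg_right x
    rw [add_apply, inner_add_right, ContinuousLinearMap.adjoint_inner_right, map_add,
      inner_re_symm (T x) x] at h
    simp only [RCLike.re_eq_complex_re] at h
    linarith
  have hinner : ∀ x, inner ℂ x ((((‖T‖ : ℂ)⁻¹) • T) x) = ((‖T‖⁻¹ : ℝ) : ℂ) * inner ℂ x (T x) :=
    fun x => by rw [smul_apply, inner_smul_right, Complex.ofReal_inv]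
  obtain ⟨f, hf, hlim⟩ := exists_orthonormal_tendsto_of_extremal (T := ((‖T‖ : ℂ)⁻¹) • T)
    (by simp [norm_smul, hTpos.ne'])
    (fun x => by
      rw [hinner, Complex.re_ofReal_mul]
      exact mul_nonneg (by positivity) (hre x))
    (fun x => by
      rw [hinner, norm_mul, Complex.norm_real, Real.norm_of_nonneg (by positivity)]
      calc √2 * (‖T‖⁻¹ * ‖inner ℂ x (T x)‖) ≤ √2 * (‖T‖⁻¹ * (numRadius T * ‖x‖ ^ 2)) := by
            gcongr
            exact norm_inner_le_numRadius T x
        _ = ‖T‖⁻¹ * ‖T‖ * ‖x‖ ^ 2 := by rw [hTw]; ring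
        _ = ‖x‖ ^ 2 := by rw [inv_mul_cancel₀ hTpos.ne', one_mul])
  -- The pairs are orthonormal only for large `m`; the remaining `U m` are arbitrary and do not
  -- affect the limit.
  obtain ⟨U, hU⟩ := (hf.mono fun m hm => exists_unitary_of_orthonormal he hm).choice
  refine ⟨U, hlim.congr' ?_⟩
  filter_upwards [hU] with m hm
  rw [leadingBlock_conj, funext hm]
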